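/- Let $T_\infty$ be the set of all finite sequences of positive integers (including the empty sequence $\emptyset$). For $s,t\in T_\infty$ write $s\le t$ if $t$ extends $s$, let $|s|$ be the length of $s$, and equip $T_\infty$ with the hyperbolic metric $\rho(s,t)=|s|+|t|-2|u|$, where $u$ is the greatest common ancestor (longest common initial segment) of $s$ and $t$. For metric spaces $(M,d)$, $(N,\delta)$ and $C\ge 1$, write $M\overset{C}{\hookrightarrow}N$ if there is an injective map $f:M\to N$ whose distortion $$\mathrm{dist}(f)=\sup_{x\ne y}\frac{\delta(f(x),f(y))}{d(x,y)}\cdot\sup_{x\ne y}\frac{d(x,y)}{\delta(f(x),f(y))}$$ is at most $C$. For a real Banach space $Y$, $\varepsilon>0$ and $K\subset Y^*$, let $s_\varepsilon K$ be the set obtained from $K$ by removing all relatively weak$^*$-open subsets of $K$ of norm diameter less than $\varepsilon$. Put $s_\varepsilon^0K=K$, $s_\varepsilon^{\alpha+1}K=s_\varepsilon(s_\varepsilon^\alpha K)$, and $s_\varepsilon^\alpha K=\bigcap_{\beta<\alpha}s_\varepsilon^\beta K$ for limit ordinals $\alpha$. Let $\mathrm{Sz}(Y,\varepsilon)$ be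 the least ordinal $\alpha$ with $s_\varepsilon^\alpha B_{Y^*}=\emptyset$ if there is one, where $B_{Y^*}$ is the closed unit ball of $Y^*$, and $\mathrm{Sz}(Y,\varepsilon)=\infty$ otherwise. The Szlenk index of $Y$ is $\mathrm{Sz}(Y)=\sup_{\varepsilon>0}\mathrm{Sz}(Y,\varepsilon)$. Let $\omega$ be the first infinite ordinal. **Theorem.** There is a universal constant $C\ge 1$ such that, for every separable real Banach space $X$ with $\mathrm{Sz}(X^*)>\omega$ (where $X^*$ is the dual space of $X$), we have $(T_\infty,\rho)\overset{C}{\hookrightarrow}X$. -/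

import Mathlib

open scoped ENNReal

/-! ### The countably branching hyperbolic tree of infinite height -/

/-- The tree `T_∞` of all finite sequences of positive integers. -/
def TInfty : Type := List ℕ+

namespace TInfty

/-- The length `|s|` of a finite sequence. -/
def length (s : TInfty) : ℕ := List.length s

/-- `s` is an ancestor of `t` (written `s ≤ t`): the sequence `t` extends `s`. -/
def IsAncestor (s t : TInfty) : Prop := List.IsPrefix s t

/-- The longest common initial segment of two finite sequences. -/
def commonPrefix : List ℕ+ → List ℕ+ → List ℕ+
  | a :: s, b :: t => if a = b then a :: commonPrefix s t else []
  | _, _ => []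

/-- The greatest common ancestor of `s` and `t`. -/
def gca (s t : TInfty) : TInfty := commonPrefix s t

theorem prefix_commonPrefix_iff (u s t : List ℕ+) :
    u <+: commonPrefix s t ↔ u <+: s ∧ u <+: t := by
  induction s generalizing u t with
  | nil =>
    simp only [commonPrefix, List.prefix_nil]
    exact ⟨fun h => ⟨h, h ▸ List.nil_prefix⟩, fun h => h.1⟩
  | cons a s ih =>
    cases t with
    | nil =>
      simp only [commonPrefix, List.prefix_nil]
      exact ⟨fun h => ⟨h ▸ List.nil_prefix, h⟩, fun h => h.2⟩
    | cons b t =>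
      cases u with
      | nil => simp
      | cons c u =>
        by_cases hab : a = b
        · subst hab
          simp only [commonPrefix, if_true, List.cons_prefix_cons, ih]
          tauto
        · simp only [commonPrefix, if_neg hab, List.cons_prefix_cons, List.prefix_nil]
          constructor
          · intro h; cases h
          · rintro ⟨⟨rfl, -⟩, rfl, -⟩; exact absurd rfl hab

theorem isAncestor_gca_iff (u s t : TInfty) :
    IsAncestor u (gca s t) ↔ IsAncestor u s ∧ IsAncestor u t :=
  prefix_commonPrefix_iff u s t

theorem IsAncestor.length_le {s t : TInfty} (h : IsAncestor s t) : s.length ≤ t.length :=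
  List.IsPrefix.length_le h

theorem gca_left (s t : TInfty) : IsAncestor (gca s t) s :=
  ((isAncestor_gca_iff (gca s t) s t).1 (List.prefix_refl _)).1

theorem gca_right (s t : TInfty) : IsAncestor (gca s t) t :=
  ((isAncestor_gca_iff (gca s t) s t).1 (List.prefix_refl _)).2

theorem IsAncestor.antisymm {s t : TInfty} (h : IsAncestor s t) (h' : IsAncestor t s) : s = t :=
  List.IsPrefix.eq_of_length h (le_antisymm h.length_le h'.length_le)

theorem gca_self (s : TInfty) : gca s s = s :=
  (gca_left s s).antisymm ((isAncestor_gca_iff s s s).2 ⟨List.prefix_refl _, List.prefix_refl _⟩)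

theorem gca_comm (s t : TInfty) : gca s t = gca t s :=
  IsAncestor.antisymm ((isAncestor_gca_iff _ _ _).2 ⟨gca_right s t, gca_left s t⟩)
    ((isAncestor_gca_iff _ _ _).2 ⟨gca_right t s, gca_left t s⟩)

theorem min_length_gca_le (s t r : TInfty) :
    min (gca s t).length (gca t r).length ≤ (gca s r).length := by
  rcases List.prefix_or_prefix_of_prefix (gca_right s t) (gca_left t r) with h | h
  · refine (min_le_left _ _).trans (IsAncestor.length_le ?_)
    exact (isAncestor_gca_iff _ _ _).2
      ⟨gca_left s t, List.IsPrefix.trans h (gca_right t r)⟩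
  · refine (min_le_right _ _).trans (IsAncestor.length_le ?_)
    exact (isAncestor_gca_iff _ _ _).2
      ⟨List.IsPrefix.trans h (gca_left s t), gca_right t r⟩

/-- The hyperbolic distance `ρ(s, t) = |s| + |t| - 2|u|`, with `u` the greatest common ancestor
of `s` and `t`. -/
noncomputable def rho (s t : TInfty) : ℝ := s.length + t.length - 2 * (gca s t).length

/-- `T_∞` is equipped with the hyperbolic distance. -/
noncomputable instance instMetricSpace : MetricSpace TInfty where
  dist := rho
  dist_self s := by
    unfold rho
    rw [gca_self]
    ring
  dist_comm s t := by
    unfold rho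
    rw [gca_comm]
    ring
  dist_triangle s t r := by
    have h1 := min_length_gca_le s t r
    have h2 := (gca_right s t).length_le
    have h3 := (gca_left t r).length_le
    have h : (gca s t).length + (gca t r).length ≤ t.length + (gca s r).length := by omega
    have h' : ((gca s t).length : ℝ) + (gca t r).length ≤ t.length + (gca s r).length := by
      exact_mod_cast h
    unfold rho
    linarith
  eq_of_dist_eq_zero {s t} hst := by
    change rho s t = 0 at hst
    unfold rho at hst
    have h1 := (gca_left s t).length_le
    have h2 := (gca_right s t).length_le
    have h : s.length + t.length = 2 * (gca s t).length := by
      have : (s.length : ℝ) + t.length = 2 * (gca s t).length := by linarith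
      exact_mod_cast this
    have hs : gca s t = s := List.IsPrefix.eq_of_length (gca_left s t) (by
      change (gca s t).length = s.length
      omega)
    have ht : gca s t = t := List.IsPrefix.eq_of_length (gca_right s t) (by
      change (gca s t).length = t.length
      omega)
    exact hs.symm.trans ht

theorem dist_def (s t : TInfty) :
    dist s t = s.length + t.length - 2 * (gca s t).length := rfl

end TInfty

/-! ### Lipschitz embeddings and their distortion -/

/-- The distortion `sup_{x ≠ y} d(f x, f y) / d(x, y) · sup_{x ≠ y} d(x, y) / d(f x, f y)`
of a map between metric spaces, in `[0, ∞]`. -/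
noncomputable def metricDistortion {M N : Type*} [MetricSpace M] [MetricSpace N] (f : M → N) :
    ℝ≥0∞ :=
  (⨆ (x : M) (y : M) (_ : x ≠ y), edist (f x) (f y) / edist x y) *
    (⨆ (x : M) (y : M) (_ : x ≠ y), edist x y / edist (f x) (f y))

/-- There is an injective map from `M` to `N` of distortion at most `C`. -/
def EmbedsWithDistortion (C : ℝ) (M N : Type*) [MetricSpace M] [MetricSpace N] : Prop :=
  ∃ f : M → N, Function.Injective f ∧ metricDistortion f ≤ ENNReal.ofReal C

/-! ### The Szlenk index -/

section Szlenk

universe u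

variable {X : Type u} [NormedAddCommGroup X] [NormedSpace ℝ X]

/-- The Szlenk derivation `s_ε K`: remove from `K ⊆ X*` all its relatively weak*-open subsets of
norm diameter less than `ε`. -/
def szlenkDerivation (ε : ℝ) (K : Set (StrongDual ℝ X)) : Set (StrongDual ℝ X) :=
  K \ ⋃₀ {V | (∃ U : Set (WeakDual ℝ X), IsOpen U ∧ V = K ∩ StrongDual.toWeakDual ⁻¹' U) ∧
    Metric.ediam V < ENNReal.ofReal ε}

/-- The transfinite iterates `s_ε^α K` of the Szlenk derivation. -/
noncomputable def szlenkIterate (ε : ℝ) (K : Set (StrongDual ℝ X)) (α : Ordinal.{u}) :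
    Set (StrongDual ℝ X) :=
  Ordinal.limitRecOn α K (fun _ L => szlenkDerivation ε L)
    (fun β _ L => ⋂ (γ : Ordinal.{u}) (h : γ < β), L γ h)

theorem szlenkIterate_zero (ε : ℝ) (K : Set (StrongDual ℝ X)) : szlenkIterate ε K 0 = K :=
  Ordinal.limitRecOn_zero ..

theorem szlenkIterate_add_one (ε : ℝ) (K : Set (StrongDual ℝ X)) (α : Ordinal.{u}) :
    szlenkIterate ε K (α + 1) = szlenkDerivation ε (szlenkIterate ε K α) :=
  Ordinal.limitRecOn_add_one ..

theorem szlenkIterate_limit (ε : ℝ) (K : Set (StrongDual ℝ X)) (α : Ordinal.{u})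
    (hα : Order.IsSuccLimit α) :
    szlenkIterate ε K α = ⋂ (β : Ordinal.{u}) (_ : β < α), szlenkIterate ε K β :=
  Ordinal.limitRecOn_limit _ _ _ _ hα

variable (X)

/-- `Sz(X, ε)`: the least ordinal `α` such that `s_ε^α B_{X*} = ∅`, and `∞` (that is, `⊤`) if there
is no such ordinal. -/
noncomputable def szlenkIndexAt (ε : ℝ) : WithTop Ordinal.{u} :=
  ⨅ (α : Ordinal.{u})
    (_ : szlenkIterate ε (Metric.closedBall (0 : StrongDual ℝ X) 1) α = ∅), (α : WithTop Ordinal.{u})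

/-- The Szlenk index `Sz(X) = sup_{ε > 0} Sz(X, ε)`. -/
noncomputable def szlenkIndex : WithTop Ordinal.{u} :=
  ⨆ (ε : ℝ) (_ : 0 < ε), szlenkIndexAt X ε

end Szlenk

/-! The embedding sends `s` to the sum of vectors `x r` over all initial segments `r` of `s`. With
all `‖x r‖ ≤ 1` this map is 1-Lipschitz; the lower bound comes from functionals `φ r` of norm at
most 1 that exceed a fixed constant on `x t` when `t` extends `r` within the same block of levels,
and are tiny on every other `x t`.

Index above `ω` yields trees of every finite height with uniform separation, not one infinite tree.
The levels are therefore cut into dyadic blocks, and a new finite tree starts at each block. Any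
interval of levels contains a proportional part lying in one block (`exists_block_subinterval`), so
one functional `φ r` detects a fixed fraction of the distance.

The constant is universal because Szlenk derivations are submultiplicative: if finitely many
derivations with parameter 1/2 emptied the ball, the same would hold for every parameter and the
index would be at most `ω`. By scaling and translation, `0` then survives every finite number of
1/4-derivations (`zero_mem_szlenkPow`), so each block can start from `0`.

Each further node costs one derivation. `exists_mem_of_mem_szlenkDerivation` gives a nearby bidual
point normed by a functional almost vanishing on all earlier data, and Goldstine's theorem replaces
that bidual point by a vector of `X`. -/

section Szlenk

variable {Y : Type*} [NormedAddCommGroup Y] [NormedSpace ℝ Y]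

/-! ### Calculus of Szlenk derivations -/

/-- A real-valued description of the Szlenk derivation. -/
theorem mem_szlenkDerivation_iff {ε : ℝ} {K : Set (StrongDual ℝ Y)} {z : StrongDual ℝ Y} :
    z ∈ szlenkDerivation ε K ↔ z ∈ K ∧ ∀ U : Set (WeakDual ℝ Y), IsOpen U →
      StrongDual.toWeakDual z ∈ U → ∀ r < ε, ∃ a ∈ K, ∃ b ∈ K,
        StrongDual.toWeakDual a ∈ U ∧ StrongDual.toWeakDual b ∈ U ∧ r < dist a b := by
  constructor
  · rintro ⟨hz, hU⟩
    refine ⟨hz, fun U hUo hzU r hr => ?_⟩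
    by_contra! hcon
    have hle : Metric.ediam (K ∩ StrongDual.toWeakDual ⁻¹' U) ≤ ENNReal.ofReal r := by
      refine Metric.ediam_le fun a ha b hb => ?_
      rw [edist_dist]
      exact ENNReal.ofReal_le_ofReal (hcon a ha.1 b hb.1 ha.2 hb.2)
    -- Testing the pair `(z, z)` excludes negative `r`, which `ENNReal.ofReal` would truncate.
    have hr0 : 0 ≤ r := by simpa using hcon z hz z hz hzU hzU
    refine hU ⟨_, ⟨⟨U, hUo, rfl⟩, hle.trans_lt ?_⟩, hz, hzU⟩
    exact (ENNReal.ofReal_lt_ofReal_iff (hr0.trans_lt hr)).2 hr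
  · rintro ⟨hz, h⟩
    refine ⟨hz, ?_⟩
    rintro ⟨V, ⟨⟨U, hUo, rfl⟩, hV⟩, -, hzU⟩
    have hfin : Metric.ediam (K ∩ StrongDual.toWeakDual ⁻¹' U) ≠ ⊤ := ne_top_of_lt hV
    have hlt : (Metric.ediam (K ∩ StrongDual.toWeakDual ⁻¹' U)).toReal < ε := by
      rcases le_or_gt ε 0 with h0 | h0
      · rw [ENNReal.ofReal_of_nonpos h0] at hV
        exact absurd hV not_lt_zero
      · exact (ENNReal.lt_ofReal_iff_toReal_lt hfin).1 hV
    obtain ⟨a, ha, b, hb, haU, hbU, hab⟩ := h U hUo hzU _ hlt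
    have h1 := Metric.edist_le_ediam_of_mem (s := K ∩ StrongDual.toWeakDual ⁻¹' U)
      ⟨ha, haU⟩ ⟨hb, hbU⟩
    have h2 := ENNReal.toReal_mono hfin h1
    rw [← dist_edist] at h2
    linarith

theorem szlenkDerivation_subset (ε : ℝ) (K : Set (StrongDual ℝ Y)) :
    szlenkDerivation ε K ⊆ K := Set.sdiff_subset

/-- The finite iterates of the Szlenk derivation. -/
def szlenkPow (ε : ℝ) (K : Set (StrongDual ℝ Y)) : ℕ → Set (StrongDual ℝ Y)
  | 0 => K
  | n + 1 => szlenkDerivation ε (szlenkPow ε K n)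

theorem szlenkIterate_natCast (ε : ℝ) (K : Set (StrongDual ℝ Y)) (n : ℕ) :
    szlenkIterate ε K n = szlenkPow ε K n := by
  induction n with
  | zero => rw [Nat.cast_zero]; exact szlenkIterate_zero ε K
  | succ n ih => rw [Nat.cast_succ, szlenkIterate_add_one, ih, szlenkPow]

theorem szlenkPow_add (ε : ℝ) (K : Set (StrongDual ℝ Y)) (m n : ℕ) :
    szlenkPow ε K (m + n) = szlenkPow ε (szlenkPow ε K m) n := by
  induction n with
  | zero => rfl
  | succ n ih => rw [← add_assoc, szlenkPow, ih, szlenkPow]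

theorem szlenkPow_subset (ε : ℝ) (K : Set (StrongDual ℝ Y)) (n : ℕ) : szlenkPow ε K n ⊆ K := by
  induction n with
  | zero => exact subset_rfl
  | succ n ih => exact (szlenkDerivation_subset _ _).trans ih

/-- Szlenk derivations commute with homotheties. -/
theorem smul_add_mem_szlenkPow {ε c : ℝ} (hc : 0 < c) (v : StrongDual ℝ Y)
    {K L : Set (StrongDual ℝ Y)} (hKL : ∀ x ∈ K, c • x + v ∈ L) (n : ℕ) :
    ∀ x ∈ szlenkPow ε K n, c • x + v ∈ szlenkPow (c * ε) L n := by
  induction n with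
  | zero => exact hKL
  | succ n ih =>
    intro x hx
    obtain ⟨hxK, hx⟩ := mem_szlenkDerivation_iff.1 hx
    refine mem_szlenkDerivation_iff.2 ⟨ih x hxK, fun U hU hxU r hr => ?_⟩
    have hcont : Continuous fun w : WeakDual ℝ Y => c • w + StrongDual.toWeakDual v :=
      (continuous_const_smul c).add continuous_const
    obtain ⟨a, ha, b, hb, haU, hbU, hab⟩ := hx _ (hU.preimage hcont) (by simpa using hxU) (r / c)
      (by rwa [div_lt_iff₀ hc, mul_comm])
    refine ⟨_, ih a ha, _, ih b hb, by simpa using haU, by simpa using hbU, ?_⟩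
    have hsub : c • a - c • b = c • (a - b) := (smul_sub c a b).symm
    rw [dist_add_right, dist_eq_norm, hsub, norm_smul, ← dist_eq_norm,
      Real.norm_of_nonneg hc.le, mul_comm]
    exact (div_lt_iff₀ hc).1 hab

theorem szlenkPow_mono {ε : ℝ} {K L : Set (StrongDual ℝ Y)} (h : K ⊆ L) (n : ℕ) :
    szlenkPow ε K n ⊆ szlenkPow ε L n := by
  intro x hx
  simpa using smul_add_mem_szlenkPow (c := 1) one_pos 0 (L := L) (by simpa using fun x hx => h hx) n x hx

/-- Szlenk derivations are local for the weak* topology. -/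
theorem szlenkPow_inter_subset {ε : ℝ} (K : Set (StrongDual ℝ Y)) {V : Set (WeakDual ℝ Y)}
    (hV : IsOpen V) (n : ℕ) :
    szlenkPow ε K n ∩ StrongDual.toWeakDual ⁻¹' V ⊆
      szlenkPow ε (K ∩ StrongDual.toWeakDual ⁻¹' V) n := by
  induction n with
  | zero => exact subset_rfl
  | succ n ih =>
    rintro x ⟨hx, hxV⟩
    obtain ⟨hxK, hx⟩ := mem_szlenkDerivation_iff.1 hx
    refine mem_szlenkDerivation_iff.2 ⟨ih ⟨hxK, hxV⟩, fun U hU hxU r hr => ?_⟩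
    obtain ⟨a, ha, b, hb, haU, hbU, hab⟩ := hx _ (hU.inter hV) ⟨hxU, hxV⟩ r hr
    exact ⟨a, ih ⟨ha, haU.2⟩, b, ih ⟨hb, hbU.2⟩, haU.1, hbU.1, hab⟩

open Metric in
/-- If the `δ`-derivation of order `n` of the unit ball is empty, then `n` derivations of
parameter `c * δ` are at least as efficient as one of parameter `c`. -/
theorem szlenkPow_subset_szlenkDerivation {δ c : ℝ} (hc : 0 < c) {n : ℕ}
    (hn : szlenkPow δ (closedBall (0 : StrongDual ℝ Y) 1) n = ∅) (K : Set (StrongDual ℝ Y)) :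
    szlenkPow (c * δ) K n ⊆ szlenkDerivation c K := by
  intro z hz
  have hzK := szlenkPow_subset _ _ _ hz
  by_contra hcon
  rw [mem_szlenkDerivation_iff] at hcon
  push Not at hcon
  obtain ⟨U, hU, hzU, r, hr, h⟩ := hcon hzK
  -- Near `z` the set `K` lies in the ball of radius `c` about `z`; rescaling this ball to the unit
  -- ball turns the parameter `c * δ` into `δ`.
  have hz' := szlenkPow_inter_subset K hU n ⟨hz, hzU⟩
  have := smul_add_mem_szlenkPow (c := c⁻¹) (inv_pos.2 hc) (-(c⁻¹ • z))
    (L := closedBall (0 : StrongDual ℝ Y) 1) (fun x hx => by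
      have hxz := h x hx.1 z hzK hx.2 hzU
      have hsub : c⁻¹ • x + -(c⁻¹ • z) = c⁻¹ • (x - z) := by
        rw [← sub_eq_add_neg]
        exact (smul_sub c⁻¹ x z).symm
      rw [mem_closedBall_zero_iff, hsub, norm_smul, norm_inv,
        Real.norm_of_nonneg hc.le, inv_mul_le_iff₀ hc, mul_one, ← dist_eq_norm]
      linarith) n z hz'
  rw [inv_mul_cancel_left₀ hc.ne', hn] at this
  exact this

open Metric in
theorem szlenkPow_mul_eq_empty {δ c : ℝ} (hc : 0 < c) {n m : ℕ}
    (hn : szlenkPow δ (closedBall (0 : StrongDual ℝ Y) 1) n = ∅)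
    (hm : szlenkPow c (closedBall (0 : StrongDual ℝ Y) 1) m = ∅) :
    szlenkPow (c * δ) (closedBall (0 : StrongDual ℝ Y) 1) (m * n) = ∅ := by
  have key : ∀ m : ℕ, szlenkPow (c * δ) (closedBall (0 : StrongDual ℝ Y) 1) (m * n) ⊆
      szlenkPow c (closedBall (0 : StrongDual ℝ Y) 1) m := by
    intro m
    induction m with
    | zero => simp [szlenkPow]
    | succ m ih =>
      rw [Nat.succ_mul, szlenkPow_add]
      exact (szlenkPow_mono ih n).trans (szlenkPow_subset_szlenkDerivation hc hn _)
  exact Set.subset_eq_empty (key m) hm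

theorem szlenkDerivation_anti {δ ε : ℝ} (h : δ ≤ ε) (K : Set (StrongDual ℝ Y)) :
    szlenkDerivation ε K ⊆ szlenkDerivation δ K := by
  intro z hz
  rw [mem_szlenkDerivation_iff] at hz ⊢
  exact ⟨hz.1, fun U hU hzU r hr => hz.2 U hU hzU r (hr.trans_le h)⟩

theorem szlenkPow_anti {δ ε : ℝ} (h : δ ≤ ε) (K : Set (StrongDual ℝ Y)) (n : ℕ) :
    szlenkPow ε K n ⊆ szlenkPow δ K n := by
  induction n with
  | zero => exact subset_rfl
  | succ n ih =>
    intro z hz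
    have hz := szlenkDerivation_anti h _ hz
    rw [mem_szlenkDerivation_iff] at hz
    refine mem_szlenkDerivation_iff.2 ⟨ih hz.1, fun U hU hzU r hr => ?_⟩
    obtain ⟨a, ha, b, hb, h'⟩ := hz.2 U hU hzU r hr
    exact ⟨a, ih ha, b, ih hb, h'⟩

-- Otherwise submultiplicativity empties the ball after finitely many derivations for each parameter
-- `(1 / 2) ^ (k + 1)`, hence for every `ε > 0`.
open Metric in
theorem szlenkPow_half_nonempty (hsz : ((Ordinal.omega0 : Ordinal) : WithTop Ordinal) <
    szlenkIndex Y) (n : ℕ) :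
    (szlenkPow (1 / 2) (closedBall (0 : StrongDual ℝ Y) 1) n).Nonempty := by
  by_contra hcon
  rw [Set.not_nonempty_iff_eq_empty] at hcon
  refine absurd hsz (not_lt.2 (iSup₂_le fun ε hε => ?_))
  have key : ∀ k : ℕ, ∃ m, szlenkPow ((1 / 2) ^ (k + 1)) (closedBall (0 : StrongDual ℝ Y) 1) m
      = ∅ := by
    intro k
    induction k with
    | zero => exact ⟨n, by simpa using hcon⟩
    | succ k ih =>
      obtain ⟨m, hm⟩ := ih
      exact ⟨m * n, by
        rw [pow_succ]
        exact szlenkPow_mul_eq_empty (by positivity) hcon hm⟩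
  obtain ⟨k, hk⟩ := exists_pow_lt_of_lt_one hε (by norm_num : (1 / 2 : ℝ) < 1)
  obtain ⟨m, hm⟩ := key k
  have hle : ((1 : ℝ) / 2) ^ (k + 1) ≤ ε :=
    (pow_le_pow_of_le_one (by norm_num) (by norm_num) k.le_succ).trans hk.le
  have hm' := Set.subset_eq_empty (szlenkPow_anti hle _ m) hm
  rw [← szlenkIterate_natCast] at hm'
  refine (iInf₂_le (m : Ordinal) hm').trans ?_
  exact_mod_cast (Ordinal.natCast_lt_omega0 m).le

-- If `x` survives with parameter 1/2, the map `y ↦ (y - x) / 2` keeps the ball inside itself, sends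
-- `x` to `0` and halves the parameter.
open Metric in
theorem zero_mem_szlenkPow (hsz : ((Ordinal.omega0 : Ordinal) : WithTop Ordinal) <
    szlenkIndex Y) (n : ℕ) :
    (0 : StrongDual ℝ Y) ∈ szlenkPow (1 / 4) (closedBall (0 : StrongDual ℝ Y) 1) n := by
  obtain ⟨x, hx⟩ := szlenkPow_half_nonempty hsz n
  have hxB := mem_closedBall_zero_iff.1 (szlenkPow_subset _ _ _ hx)
  have := smul_add_mem_szlenkPow (c := 1 / 2) (by norm_num) (-((1 / 2 : ℝ) • x))
    (L := closedBall (0 : StrongDual ℝ Y) 1) (fun y hy => by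
      have hy := mem_closedBall_zero_iff.1 hy
      rw [mem_closedBall_zero_iff]
      refine (norm_add_le _ _).trans ?_
      rw [norm_neg, norm_smul, norm_smul, Real.norm_of_nonneg (by norm_num)]
      linarith) n x hx
  rw [add_neg_cancel] at this
  convert this using 2
  norm_num

/-! ### Norming vectors and Goldstine's theorem -/

/-- A point surviving a Szlenk derivation has weak*-close neighbours that are normed by functionals
almost vanishing on a prescribed finite set. -/
theorem exists_mem_of_mem_szlenkDerivation {ε δ η : ℝ} (hη : 0 < η) (hδ : 4 * δ + 6 * η < ε)
    {K : Set (StrongDual ℝ Y)} {z : StrongDual ℝ Y} (hz : z ∈ szlenkDerivation ε K)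
    {U : Set (WeakDual ℝ Y)} (hU : IsOpen U) (hzU : StrongDual.toWeakDual z ∈ U)
    (E : Finset (StrongDual ℝ Y)) :
    ∃ w ∈ K, StrongDual.toWeakDual w ∈ U ∧ ∃ y : Y, ‖y‖ ≤ 1 ∧ δ < w y ∧ ∀ f ∈ E, |f y| < η := by
  classical
  by_contra! hcon
  let E' : Finset (StrongDual ℝ Y) := insert z E
  let T : Y →L[ℝ] (E' → ℝ) := ContinuousLinearMap.pi fun f => (f : StrongDual ℝ Y)
  have hTB : TotallyBounded (T '' Metric.closedBall 0 1) := by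
    have hb : Bornology.IsBounded (T '' Metric.closedBall 0 1) :=
      T.lipschitz.isBounded_image Metric.isBounded_closedBall
    -- The values of `E'` on the unit ball fill a bounded set in finite dimension, so finitely many
    -- vectors `g v` approximate them all.
    exact hb.isCompact_closure.totallyBounded.subset subset_closure
  obtain ⟨N, hNsub, hN, hcov⟩ := Metric.finite_approx_of_totallyBounded hTB η hη
  have hNimg : ∀ v ∈ N, ∃ y ∈ Metric.closedBall (0 : Y) 1, T y = v := fun v hv => hNsub hv
  choose! g hgB hg using hNimg
  let U' : Set (WeakDual ℝ Y) := U ∩ ⋂ v ∈ N, {w | |w (g v) - z (g v)| < η}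
  have hU' : IsOpen U' := hU.inter <| hN.isOpen_biInter fun v _ =>
    isOpen_lt ((WeakDual.eval_continuous (g v)).sub continuous_const).abs continuous_const
  have hzU' : StrongDual.toWeakDual z ∈ U' := ⟨hzU, by simp [hη]⟩
  obtain ⟨a, ha, b, hb, haU, hbU, hab⟩ := (mem_szlenkDerivation_iff.1 hz).2 U' hU' hzU' _ hδ
  have key : ∀ w ∈ K, StrongDual.toWeakDual w ∈ U' → ∀ y : Y, ‖y‖ ≤ 1 →
      w y - z y ≤ 2 * δ + 2 * η := by
    intro w hwK hwU y hy
    have hTy := hcov ⟨y, mem_closedBall_zero_iff.2 hy, rfl⟩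
    simp only [Set.mem_iUnion, exists_prop] at hTy
    obtain ⟨v, hvN, hv⟩ := hTy
    have hgy := mem_closedBall_zero_iff.1 (hgB v hvN)
    have hclose : ∀ f ∈ E', |f y - f (g v)| < η := fun f hf => by
      have h1 := (dist_le_pi_dist (T y) v ⟨f, hf⟩).trans_lt hv
      rw [← hg v hvN] at h1
      exact h1
    -- The vector `(y - g v) / 2` is in the unit ball and almost killed by `E`, so `w` is at most
    -- `δ` there; since `z ∈ E'` and `w` is close to `z` at `g v`, this bounds `w y - z y`.
    have hhalf : ∀ f : StrongDual ℝ Y, f ((1 / 2 : ℝ) • (y - g v)) = 1 / 2 * (f y - f (g v)) :=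
      fun f => by rw [map_smul, map_sub, smul_eq_mul]
    have hh : ‖(1 / 2 : ℝ) • (y - g v)‖ ≤ 1 := by
      rw [norm_smul, Real.norm_of_nonneg (by norm_num)]
      linarith [norm_sub_le y (g v)]
    have hwh : w ((1 / 2 : ℝ) • (y - g v)) ≤ δ := by
      by_contra! hlt
      obtain ⟨f, hf, hfη⟩ := hcon w hwK hwU.1 _ hh hlt
      rw [hhalf, abs_mul, abs_of_nonneg (by norm_num)] at hfη
      linarith [hclose f (Finset.mem_insert_of_mem hf)]
    rw [hhalf] at hwh
    have h2 := abs_lt.1 (hclose z (Finset.mem_insert_self _ _))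
    have h3 : |w (g v) - z (g v)| < η := Set.mem_iInter₂.1 hwU.2 v hvN
    linarith [(abs_lt.1 h3).2]
  have hnorm : ∀ w ∈ K, StrongDual.toWeakDual w ∈ U' → ‖w - z‖ ≤ 2 * δ + 2 * η := by
    intro w hwK hwU
    have h0 : 0 ≤ 2 * δ + 2 * η := by simpa using key w hwK hwU 0 (by simp)
    refine ContinuousLinearMap.opNorm_le_of_unit_norm h0 fun y hy => ?_
    have h1 := key w hwK hwU y hy.le
    have h2 := key w hwK hwU (-y) (by rw [norm_neg, hy])
    rw [map_neg, map_neg] at h2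
    rw [sub_apply, Real.norm_eq_abs, abs_le]
    constructor <;> linarith
  have h1 := hnorm a ha haU
  have h2 := hnorm b hb hbU
  have h3 := dist_triangle_right a b z
  rw [dist_eq_norm a z, dist_eq_norm b z] at h3
  linarith

end Szlenk

/-- Goldstine's theorem for finitely many functionals. -/
theorem exists_norm_le_one_abs_sub_lt {X : Type*} [NormedAddCommGroup X] [NormedSpace ℝ X]
    {z : StrongDual ℝ (StrongDual ℝ X)} (hz : ‖z‖ ≤ 1) (F : Finset (StrongDual ℝ X)) {η : ℝ}
    (hη : 0 < η) : ∃ x : X, ‖x‖ ≤ 1 ∧ ∀ φ ∈ F, |φ x - z φ| < η := by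
  classical
  let T : X →L[ℝ] (F → ℝ) := ContinuousLinearMap.pi fun f => (f : StrongDual ℝ X)
  let p : F → ℝ := fun φ => z φ
  have hp : p ∈ closure (T '' Metric.closedBall 0 1) := by
    by_contra hp
    -- A separating functional pulls back to some `ψ` in the dual of `X` with `‖ψ‖ ≤ u < z ψ`,
    -- contradicting `‖z‖ ≤ 1`.
    obtain ⟨f, u, hu, hup⟩ := geometric_hahn_banach_closed_point
      (((convex_closedBall (0 : X) 1).linear_image T.toLinearMap).closure) isClosed_closure hp
    have hf : ∀ v : F → ℝ, f v = ∑ φ, v φ * f (Pi.single φ 1) := fun v => by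
      conv_lhs => rw [pi_eq_sum_univ' v, map_sum]
      exact Finset.sum_congr rfl fun φ _ => by rw [map_smul, smul_eq_mul]
    let ψ : StrongDual ℝ X := f.comp T
    have hψ : ψ = ∑ φ : F, f (Pi.single φ 1) • (φ : StrongDual ℝ X) := by
      ext x
      simp only [ψ, ContinuousLinearMap.comp_apply, hf (T x), sum_apply,
        smul_apply, smul_eq_mul]
      exact Finset.sum_congr rfl fun φ _ => mul_comm _ _
    have hzψ : z ψ = f p := by
      rw [hψ, map_sum, hf p]
      exact Finset.sum_congr rfl fun φ _ => by rw [map_smul, smul_eq_mul, mul_comm]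
    have hlt : ∀ x : X, ‖x‖ ≤ 1 → ψ x < u := fun x hx =>
      hu _ (subset_closure ⟨x, mem_closedBall_zero_iff.2 hx, rfl⟩)
    have hu0 : 0 ≤ u := by simpa using (hlt 0 (by simp)).le
    have hψu : ‖ψ‖ ≤ u := by
      refine ContinuousLinearMap.opNorm_le_of_unit_norm hu0 fun x hx => ?_
      rw [Real.norm_eq_abs, abs_le]
      have h1 := hlt x hx.le
      have h2 := hlt (-x) (by rw [norm_neg, hx])
      rw [map_neg] at h2
      constructor <;> linarith
    have h3 : z ψ ≤ ‖ψ‖ := (le_abs_self _).trans ((z.le_opNorm ψ).trans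
      (mul_le_of_le_one_left (norm_nonneg _) hz))
    linarith
  obtain ⟨_, ⟨x, hx, rfl⟩, hxp⟩ := Metric.mem_closure_iff.1 hp η hη
  refine ⟨x, mem_closedBall_zero_iff.1 hx, fun φ hφ => ?_⟩
  rw [dist_comm] at hxp
  exact (dist_le_pi_dist (T x) p ⟨φ, hφ⟩).trans_lt hxp

/-! ### Recursive choice and enumeration of the tree -/

/-- Dependent choice along an index set ranked by natural numbers: the value at `s` is subject to a
condition involving the values at indices of smaller rank. -/
theorem exists_forall_of_rank {ι α : Type*} [Inhabited α] (e : ι → ℕ)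
    (P : ι → (ι → α) → α → Prop)
    (hloc : ∀ s g g' a, (∀ t, e t < e s → g t = g' t) → P s g a → P s g' a)
    (hstep : ∀ s g, (∀ t, e t < e s → P t g (g t)) → ∃ a, P s g a) :
    ∃ g : ι → α, ∀ s, P s g (g s) := by
  classical
  let F : (s : ι) → ((t : ι) → e t < e s → α) → α := fun s rec =>
    -- Values at indices not of smaller rank are filled with `default`, which is harmless by `hloc`.
    if h : ∃ a, P s (fun t => if ht : e t < e s then rec t ht else default) a then h.choose
    else default
  let g : ι → α := (measure e).wf.fix F
  have hg : ∀ s, g s = F s fun t _ => g t := fun s => (measure e).wf.fix_eq F s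
  have main : ∀ n s, e s = n → P s g (g s) := by
    intro n
    induction n using Nat.strong_induction_on with
    | _ n ih =>
      rintro s rfl
      obtain ⟨a, ha⟩ := hstep s g fun t ht => ih (e t) ht t rfl
      have hex : ∃ a, P s (fun t => if ht : e t < e s then g t else default) a :=
        ⟨a, hloc s _ _ a (fun t ht => by simp [ht]) ha⟩
      have hgs : g s = hex.choose := by
        rw [hg]
        exact dif_pos hex
      rw [hgs]
      exact hloc s _ _ _ (fun t ht => by simp [ht]) hex.choose_spec
  exact ⟨g, fun s => main _ s rfl⟩

/-- An enumeration of finite sequences in which initial segments come first. -/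
def prefixRank (s : List ℕ+) : ℕ := Encodable.encode s.reverse

theorem prefixRank_injective : Function.Injective prefixRank :=
  Encodable.encode_injective.comp List.reverse_injective

/-- Reversal turns appending a letter into consing one, and a list has a larger code than its tail.
-/
theorem prefixRank_le_of_prefix {s t : List ℕ+} (h : s <+: t) : prefixRank s ≤ prefixRank t := by
  obtain ⟨u, rfl⟩ := h
  induction u using List.reverseRecOn with
  | nil => simp
  | append_singleton u a ih =>
    refine ih.trans ?_
    have hrev : (s ++ (u ++ [a])).reverse = a :: (s ++ u).reverse := by simp
    rw [prefixRank, prefixRank, hrev, Encodable.encode_list_cons]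
    exact (Nat.right_le_pair _ _).trans (Nat.le_succ _)

/-- The levels of the tree are grouped in the blocks `[2 ^ k - 1, 2 ^ (k + 1) - 1)`. -/
def levelBlock (s : List ℕ+) : ℕ := Nat.log 2 (s.length + 1)

/-- `r` is an initial segment of `t` in the same block of levels. -/
def BlockPrefix (r t : List ℕ+) : Prop := r <+: t ∧ levelBlock r = levelBlock t

theorem levelBlock_mono {s t : List ℕ+} (h : s <+: t) : levelBlock s ≤ levelBlock t :=
  Nat.log_mono_right (Nat.succ_le_succ h.length_le)

/-- The number of levels strictly above `s` in its block, plus one. -/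
def blockHeight (s : List ℕ+) : ℕ := 2 ^ (levelBlock s + 1) - (s.length + 1)

/-! ### Construction of the tree in blocks -/

section Tree

variable {X : Type*} [NormedAddCommGroup X] [NormedSpace ℝ X]

open Metric in
/-- One step of the construction of a tree in a bidual: the conditions that the triple at `s`,
consisting of a point of the bidual, a functional and a point of the space, must satisfy with respect
to the triples constructed before. -/
structure IsTreeStep (s : List ℕ+)
    (g : List ℕ+ → StrongDual ℝ (StrongDual ℝ X) × StrongDual ℝ X × X)
    (a : StrongDual ℝ (StrongDual ℝ X) × StrongDual ℝ X × X) : Prop where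
  mem : a.1 ∈ szlenkPow (1 / 4) (closedBall (0 : StrongDual ℝ (StrongDual ℝ X)) 1) (blockHeight s)
  norm_functional : ‖a.2.1‖ ≤ 1
  norm_point : ‖a.2.2‖ ≤ 1
  self_bidual : 1 / 20 < a.1 a.2.1
  self_point : 1 / 20 < a.2.1 a.2.2
  functional_small : ∀ t, prefixRank t < prefixRank s →
    |(g t).1 a.2.1| < 1 / 320 ∧ |a.2.1 (g t).2.2| < 1 / 320
  large : ∀ t, prefixRank t < prefixRank s → BlockPrefix t s →
    1 / 20 < a.1 (g t).2.1 ∧ 1 / 20 < (g t).2.1 a.2.2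
  small : ∀ t, prefixRank t < prefixRank s → ¬ BlockPrefix t s →
    |a.1 (g t).2.1| < 1 / 320 ∧ |(g t).2.1 a.2.2| < 1 / 320

theorem IsTreeStep.congr {s : List ℕ+}
    {g g' : List ℕ+ → StrongDual ℝ (StrongDual ℝ X) × StrongDual ℝ X × X}
    {a : StrongDual ℝ (StrongDual ℝ X) × StrongDual ℝ X × X}
    (h : ∀ t, prefixRank t < prefixRank s → g t = g' t) (ha : IsTreeStep s g a) :
    IsTreeStep s g' a where
  mem := ha.mem
  norm_functional := ha.norm_functional
  norm_point := ha.norm_point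
  self_bidual := ha.self_bidual
  self_point := ha.self_point
  functional_small t ht := h t ht ▸ ha.functional_small t ht
  large t ht := h t ht ▸ ha.large t ht
  small t ht := h t ht ▸ ha.small t ht

open Metric in
/-- The point of the bidual from which the point at `s` is obtained: the point at the parent of `s`,
or `0` at the beginning of a block. -/
theorem exists_base
    (h0 : ∀ n, (0 : StrongDual ℝ (StrongDual ℝ X)) ∈ szlenkPow (1 / 4) (closedBall 0 1) n)
    {s : List ℕ+} {g : List ℕ+ → StrongDual ℝ (StrongDual ℝ X) × StrongDual ℝ X × X}
    (hg : ∀ t, prefixRank t < prefixRank s → IsTreeStep t g (g t)) :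
    ∃ b : StrongDual ℝ (StrongDual ℝ X),
      b ∈ szlenkPow (1 / 4) (closedBall (0 : StrongDual ℝ (StrongDual ℝ X)) 1)
        (blockHeight s + 1) ∧
      (∀ t, prefixRank t < prefixRank s → BlockPrefix t s → 1 / 20 < b (g t).2.1) ∧
      ∀ t, prefixRank t < prefixRank s → ¬ BlockPrefix t s → |b (g t).2.1| < 1 / 320 := by
  have hzero : (∀ t, prefixRank t < prefixRank s → ¬ BlockPrefix t s) → ∃ b : StrongDual ℝ
      (StrongDual ℝ X), b ∈ szlenkPow (1 / 4) (closedBall (0 : StrongDual ℝ (StrongDual ℝ X)) 1)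
        (blockHeight s + 1) ∧
      (∀ t, prefixRank t < prefixRank s → BlockPrefix t s → 1 / 20 < b (g t).2.1) ∧
      ∀ t, prefixRank t < prefixRank s → ¬ BlockPrefix t s → |b (g t).2.1| < 1 / 320 := fun h =>
    ⟨0, h0 _, fun t ht hts => absurd hts (h t ht), fun t ht _ => by simp⟩
  have hprefix : ∀ t l : List ℕ+, ∀ c, t <+: l ++ [c] → prefixRank t < prefixRank (l ++ [c]) →
      t <+: l := fun t l c h hlt => by
    rcases List.prefix_concat_iff.1 h with rfl | h
    · exact absurd hlt (lt_irrefl _)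
    · exact h
  rcases List.eq_nil_or_concat s with rfl | ⟨l, c, hs⟩
  · refine hzero fun t ht hts => ?_
    rw [List.prefix_nil.1 hts.1] at ht
    exact lt_irrefl _ ht
  rw [List.concat_eq_append] at hs
  subst hs
  by_cases hblock : levelBlock l = levelBlock (l ++ [c])
  · have hl : l <+: l ++ [c] := List.prefix_append _ _
    have hlt : prefixRank l < prefixRank (l ++ [c]) :=
      (prefixRank_le_of_prefix hl).lt_of_ne fun h => by
        simpa using congrArg List.length (prefixRank_injective h)
    have hgl := hg l hlt
    refine ⟨(g l).1, ?_, fun t ht hts => ?_, fun t ht hts => ?_⟩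
    · have hlog : (l ++ [c]).length + 1 < 2 ^ (levelBlock (l ++ [c]) + 1) :=
        Nat.lt_pow_succ_log_self one_lt_two _
      have : blockHeight (l ++ [c]) + 1 = blockHeight l := by
        unfold blockHeight
        rw [hblock]
        rw [List.length_append, List.length_singleton] at hlog ⊢
        omega
      rw [this]
      exact hgl.mem
    · have htl := hprefix t l c hts.1 ht
      rcases (prefixRank_le_of_prefix htl).eq_or_lt with heq | htlt
      · rw [prefixRank_injective heq]
        exact hgl.self_bidual
      · exact (hgl.large t htlt ⟨htl, hts.2.trans hblock.symm⟩).1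
    · have htl : ¬ BlockPrefix t l := fun h => hts ⟨h.1.trans hl, h.2.trans hblock⟩
      rcases lt_trichotomy (prefixRank t) (prefixRank l) with h | h | h
      · exact (hgl.small t h htl).1
      · rw [prefixRank_injective h] at htl
        exact absurd ⟨List.prefix_rfl, rfl⟩ htl
      -- Here `t` was treated after `l`, and its functional was chosen almost vanishing at the
      -- bidual point of `l`.
      · exact ((hg t ht).functional_small l h).1
  -- A block prefix `t` of smaller rank would be a prefix of `l`, forcing `l` into the block of `s`.
  · refine hzero fun t ht hts => hblock ?_
    have h1 := levelBlock_mono (hprefix t l c hts.1 ht)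
    rw [hts.2] at h1
    exact (levelBlock_mono (List.prefix_append l [c])).antisymm h1

-- The base point survives one derivation more than `s` requires; spending it gives `z` and `φ`, and
-- `z` is then approximated by a vector of `X`.
open Metric in
theorem exists_isTreeStep
    (h0 : ∀ n, (0 : StrongDual ℝ (StrongDual ℝ X)) ∈ szlenkPow (1 / 4) (closedBall 0 1) n)
    {s : List ℕ+} {g : List ℕ+ → StrongDual ℝ (StrongDual ℝ X) × StrongDual ℝ X × X}
    (hg : ∀ t, prefixRank t < prefixRank s → IsTreeStep t g (g t)) : ∃ a, IsTreeStep s g a := by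
  classical
  obtain ⟨b, hb, hblarge, hbsmall⟩ := exists_base h0 hg
  have hfin : {t : List ℕ+ | prefixRank t < prefixRank s}.Finite :=
    (Set.finite_Iio (prefixRank s)).preimage prefixRank_injective.injOn
  let I := hfin.toFinset
  have hI : ∀ t, t ∈ I ↔ prefixRank t < prefixRank s := fun t => by simp [I]
  let U : Set (WeakDual ℝ (StrongDual ℝ X)) :=
    ⋂ t ∈ I, {w | (BlockPrefix t s → 1 / 20 < w (g t).2.1) ∧
      (¬ BlockPrefix t s → |w (g t).2.1| < 1 / 320)}
  have hU : IsOpen U := by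
    refine isOpen_biInter_finset fun t _ => ?_
    by_cases h : BlockPrefix t s
    · simpa [h] using isOpen_lt continuous_const (WeakDual.eval_continuous (g t).2.1)
    · simpa [h] using isOpen_lt (WeakDual.eval_continuous (g t).2.1).abs continuous_const
  have hbU : StrongDual.toWeakDual b ∈ U := Set.mem_iInter₂.2 fun t ht =>
    ⟨hblarge t ((hI t).1 ht), hbsmall t ((hI t).1 ht)⟩
  -- Admissible since `4 / 20 + 6 / 320 < 1 / 4`.
  obtain ⟨z, hz, hzU, φ, hφ, hzφ, hφE⟩ := exists_mem_of_mem_szlenkDerivation (δ := 1 / 20)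
    (η := 1 / 320) (by norm_num) (by norm_num) hb hU hbU
    (I.image (fun t => (g t).1) ∪
      I.image fun t => NormedSpace.inclusionInDoubleDual ℝ X (g t).2.2)
  have hzU' : ∀ t, prefixRank t < prefixRank s → (BlockPrefix t s → 1 / 20 < z (g t).2.1) ∧
      (¬ BlockPrefix t s → |z (g t).2.1| < 1 / 320) := fun t ht =>
    Set.mem_iInter₂.1 hzU t ((hI t).2 ht)
  have hz1 : ‖z‖ ≤ 1 := mem_closedBall_zero_iff.1 (szlenkPow_subset _ _ _ hz)
  -- Finitely many strict inequalities hold with a common margin `η`, so they pass from `z` to any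
  -- `η`-approximation.
  obtain ⟨η, hη, hηI⟩ : ∃ η > 0, ∀ ψ ∈ insert φ (I.image fun t => (g t).2.1),
      (1 / 20 < z ψ → η < z ψ - 1 / 20) ∧ (|z ψ| < 1 / 320 → η < 1 / 320 - |z ψ|) := by
    generalize insert φ (I.image fun t => (g t).2.1) = F
    induction F using Finset.induction_on with
    | empty => exact ⟨1, one_pos, by simp⟩
    | insert ψ F _ ih =>
      obtain ⟨η, hη, hF⟩ := ih
      obtain ⟨η', hη', h1⟩ : ∃ η' > 0, 1 / 20 < z ψ → η' < z ψ - 1 / 20 := by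
        by_cases h : 1 / 20 < z ψ
        · obtain ⟨c, hc, hc'⟩ := exists_between (sub_pos.2 h)
          exact ⟨c, hc, fun _ => hc'⟩
        · exact ⟨1, one_pos, fun h' => absurd h' h⟩
      obtain ⟨η'', hη'', h2⟩ : ∃ η' > 0, |z ψ| < 1 / 320 → η' < 1 / 320 - |z ψ| := by
        by_cases h : |z ψ| < 1 / 320
        · obtain ⟨c, hc, hc'⟩ := exists_between (sub_pos.2 h)
          exact ⟨c, hc, fun _ => hc'⟩
        · exact ⟨1, one_pos, fun h' => absurd h' h⟩
      refine ⟨min η (min η' η''), lt_min hη (lt_min hη' hη''), fun χ hχ => ?_⟩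
      have m1 := min_le_left η (min η' η'')
      have m2 := (min_le_right η (min η' η'')).trans (min_le_left _ _)
      have m3 := (min_le_right η (min η' η'')).trans (min_le_right _ _)
      rcases Finset.mem_insert.1 hχ with rfl | hχ
      · exact ⟨fun h => m2.trans_lt (h1 h), fun h => m3.trans_lt (h2 h)⟩
      · exact ⟨fun h => m1.trans_lt ((hF χ hχ).1 h), fun h => m1.trans_lt ((hF χ hχ).2 h)⟩
  obtain ⟨x, hx, hxF⟩ :=
    exists_norm_le_one_abs_sub_lt hz1 (insert φ (I.image fun t => (g t).2.1)) hη
  have hlarge : ∀ ψ ∈ insert φ (I.image fun t => (g t).2.1), 1 / 20 < z ψ → 1 / 20 < ψ x := by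
    intro ψ hψ h
    linarith [(hηI ψ hψ).1 h, (abs_lt.1 (hxF ψ hψ)).1]
  have hsmall : ∀ ψ ∈ insert φ (I.image fun t => (g t).2.1), |z ψ| < 1 / 320 →
      |ψ x| < 1 / 320 := by
    intro ψ hψ h
    linarith [(hηI ψ hψ).2 h, hxF ψ hψ, abs_sub_abs_le_abs_sub (ψ x) (z ψ)]
  have hmem : ∀ t, prefixRank t < prefixRank s →
      (g t).2.1 ∈ insert φ (I.image fun t => (g t).2.1) := fun t ht =>
    Finset.mem_insert_of_mem (Finset.mem_image_of_mem _ ((hI t).2 ht))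
  exact ⟨(z, φ, x), {
    mem := hz
    norm_functional := hφ
    norm_point := hx
    self_bidual := hzφ
    self_point := hlarge φ (Finset.mem_insert_self _ _) hzφ
    functional_small := fun t ht =>
      ⟨hφE _ (Finset.mem_union_left _ (Finset.mem_image_of_mem _ ((hI t).2 ht))),
        hφE _ (Finset.mem_union_right _ (Finset.mem_image_of_mem _ ((hI t).2 ht)))⟩
    large := fun t ht hts => ⟨(hzU' t ht).1 hts, hlarge _ (hmem t ht) ((hzU' t ht).1 hts)⟩
    small := fun t ht hts => ⟨(hzU' t ht).2 hts, hsmall _ (hmem t ht) ((hzU' t ht).2 hts)⟩ }⟩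

/-- If the dual of `X` has Szlenk index larger than `ω`, then `X` contains a countably branching tree
together with a tree of functionals which are almost biorthogonal on every block of levels. -/
theorem exists_tree (hsz : ((Ordinal.omega0 : Ordinal) : WithTop Ordinal) <
    szlenkIndex (StrongDual ℝ X)) :
    ∃ (x : List ℕ+ → X) (φ : List ℕ+ → StrongDual ℝ X), (∀ s, ‖x s‖ ≤ 1) ∧ (∀ s, ‖φ s‖ ≤ 1) ∧
      (∀ r t, BlockPrefix r t → 1 / 20 < φ r (x t)) ∧
      ∀ r t, ¬ BlockPrefix r t → |φ r (x t)| < 1 / 320 := by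
  have : Inhabited (StrongDual ℝ (StrongDual ℝ X) × StrongDual ℝ X × X) := ⟨(0, 0, 0)⟩
  obtain ⟨g, hg⟩ := exists_forall_of_rank prefixRank (IsTreeStep (X := X))
    (fun s g g' a h ha => ha.congr h)
    (fun s g h => exists_isTreeStep (zero_mem_szlenkPow hsz) h)
  refine ⟨fun s => (g s).2.2, fun s => (g s).2.1, fun s => (hg s).norm_point,
    fun s => (hg s).norm_functional, fun r t hrt => ?_, fun r t hrt => ?_⟩
  · rcases (prefixRank_le_of_prefix hrt.1).eq_or_lt with h | h
    · rw [prefixRank_injective h]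
      exact (hg t).self_point
    · exact ((hg t).large r h hrt).2
  · rcases lt_trichotomy (prefixRank r) (prefixRank t) with h | h | h
    · exact ((hg t).small r h hrt).2
    · rw [prefixRank_injective h] at hrt
      exact absurd ⟨List.prefix_rfl, rfl⟩ hrt
    · exact ((hg r).functional_small t h).2

end Tree

/-! ### Dyadic blocks in an interval of levels -/

/-- A sub-interval of `(a, b]` of proportional length which is contained in one block of levels. -/
theorem exists_block_subinterval {a b : ℕ} (hab : a < b) :
    ∃ j k, a < j ∧ j ≤ k ∧ k ≤ b ∧ Nat.log 2 (j + 1) = Nat.log 2 (k + 1) ∧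
      b - a ≤ 4 * (k + 1 - j) := by
  obtain ⟨K, hK⟩ : ∃ K, Nat.log 2 (b + 1) = K := ⟨_, rfl⟩
  have h1 : 2 ^ K ≤ b + 1 := hK ▸ Nat.pow_log_le_self 2 (Nat.succ_ne_zero b)
  have h2 : b + 1 < 2 ^ (K + 1) := hK ▸ Nat.lt_pow_succ_log_self one_lt_two _
  have hlog : ∀ i M : ℕ, 2 ^ M ≤ i + 1 → i + 1 < 2 ^ (M + 1) → Nat.log 2 (i + 1) = M :=
    fun i M => Nat.log_eq_of_pow_le_of_lt_pow
  by_cases h3 : 2 ^ K ≤ a + 2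
  · exact ⟨a + 1, b, by omega, by omega, le_rfl,
      (hlog _ K h3 (by omega)).trans (hlog _ K h1 h2).symm, by omega⟩
  by_cases h4 : b - a ≤ 4 * (b + 1 - (2 ^ K - 1))
  · exact ⟨2 ^ K - 1, b, by omega, by omega, le_rfl,
      (hlog _ K (by omega) (by omega)).trans (hlog _ K h1 h2).symm, h4⟩
  obtain ⟨M, rfl⟩ : ∃ M, K = M + 1 := ⟨K - 1, by
    rcases K with _ | K
    · simp at h3
    · simp⟩
  have h5 : 2 ^ (M + 1) = 2 * 2 ^ M := by ring
  -- The last block now holds less than a quarter of the interval. The block before it has `2 ^ M`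
  -- levels, more than half of all levels up to its end, so it holds over half of what remains.
  refine ⟨max (a + 1) (2 ^ M - 1), 2 ^ (M + 1) - 2, by omega, by omega, by omega, ?_, by omega⟩
  exact (hlog _ M (by omega) (by omega)).trans (hlog _ M (by omega) (by omega)).symm

/-! ### Metric estimates for branch sums -/

section BranchSum

variable {X : Type*} [NormedAddCommGroup X]

/-- The sum of the values of `x` at all initial segments of `s`. -/
def branchSum (x : List ℕ+ → X) (s : List ℕ+) : X :=
  ∑ i ∈ Finset.Ico 0 (s.length + 1), x (s.take i)

theorem branchSum_of_prefix (x : List ℕ+ → X) {u s : List ℕ+} (h : u <+: s) :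
    branchSum x s =
      branchSum x u + ∑ i ∈ Finset.Ico (u.length + 1) (s.length + 1), x (s.take i) := by
  unfold branchSum
  rw [← Finset.sum_Ico_consecutive _ (Nat.zero_le (u.length + 1)) (Nat.succ_le_succ h.length_le)]
  congr 1
  refine Finset.sum_congr rfl fun i hi => ?_
  obtain ⟨v, rfl⟩ := h
  rw [List.take_append_of_le_length (by have := (Finset.mem_Ico.1 hi).2; omega)]

theorem branchSum_sub_branchSum (x : List ℕ+ → X) {u s t : List ℕ+} (hs : u <+: s)
    (ht : u <+: t) : branchSum x s - branchSum x t =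
      ∑ i ∈ Finset.Ico (u.length + 1) (s.length + 1), x (s.take i) -
        ∑ i ∈ Finset.Ico (u.length + 1) (t.length + 1), x (t.take i) := by
  rw [branchSum_of_prefix x hs, branchSum_of_prefix x ht, add_sub_add_left_eq_sub]

theorem norm_branchSum_sub_le {x : List ℕ+ → X} (hx : ∀ s, ‖x s‖ ≤ 1) {u s t : List ℕ+}
    (hs : u <+: s) (ht : u <+: t) :
    ‖branchSum x s - branchSum x t‖ ≤ s.length + t.length - 2 * u.length := by
  have key : ∀ v : List ℕ+, u <+: v →
      ‖∑ i ∈ Finset.Ico (u.length + 1) (v.length + 1), x (v.take i)‖ ≤ v.length - u.length := by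
    intro v hv
    refine (norm_sum_le_of_le _ fun i _ => hx (v.take i)).trans_eq ?_
    rw [Finset.sum_const, Nat.card_Ico, nsmul_eq_mul, mul_one, Nat.add_sub_add_right,
      Nat.cast_sub hv.length_le]
  rw [branchSum_sub_branchSum x hs ht]
  linarith [norm_sub_le (∑ i ∈ Finset.Ico (u.length + 1) (s.length + 1), x (s.take i))
    (∑ i ∈ Finset.Ico (u.length + 1) (t.length + 1), x (t.take i)), key s hs, key t ht]

/-- With `L = |s| - |u|`, test with `φ` at `s.take j`, where `j` starts a one-block interval of at
least `L / 4` levels. Those levels contribute at least `16 / 320` each; any other term costs at most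
`1 / 320`. The result is at least `(17 / 4 - 2) * L / 320`, while the distance is at most `2 * L`;
the ratio `2560 / 9` is below 300. -/
theorem le_norm_branchSum_sub [NormedSpace ℝ X] {x : List ℕ+ → X} {φ : List ℕ+ → StrongDual ℝ X}
    (hφ : ∀ s, ‖φ s‖ ≤ 1) (hlarge : ∀ r t, BlockPrefix r t → 1 / 20 < φ r (x t))
    (hsmall : ∀ r t, ¬ BlockPrefix r t → |φ r (x t)| < 1 / 320) {u s t : List ℕ+}
    (hs : u <+: s) (ht : u <+: t) (hu : ∀ v, v <+: s → v <+: t → v <+: u)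
    (hts : t.length ≤ s.length) :
    s.length + t.length - 2 * u.length ≤ 300 * ‖branchSum x s - branchSum x t‖ := by
  have hus := hs.length_le
  have hut := ht.length_le
  rcases hus.eq_or_lt with heq | hlt
  · have h1 : (s.length : ℝ) = u.length := by rw [heq]
    have h2 : (t.length : ℝ) ≤ s.length := by exact_mod_cast hts
    have := norm_nonneg (branchSum x s - branchSum x t)
    linarith
  obtain ⟨j, k, huj, hjk, hks, hlog, hcard⟩ := exists_block_subinterval hlt
  have hlen : ∀ i ≤ s.length, (s.take i).length = i := fun i hi => List.length_take_of_le hi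
  have hS : ∀ i ∈ Finset.Ico (u.length + 1) (s.length + 1),
      (if i ∈ Finset.Icc j k then (17 / 320 : ℝ) else 0) - 1 / 320 ≤
        φ (s.take j) (x (s.take i)) := by
    intro i hi
    split_ifs with hijk
    · rw [Finset.mem_Icc] at hijk
      refine (le_of_eq (by norm_num)).trans (hlarge _ _ ⟨?_, ?_⟩).le
      · exact List.take_prefix_take_left hijk.1
      · unfold levelBlock
        rw [hlen j (hjk.trans hks), hlen i (hijk.2.trans hks)]
        refine (Nat.log_mono_right (by omega)).antisymm ?_
        rw [hlog]
        exact Nat.log_mono_right (by omega)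
    · by_cases hb : BlockPrefix (s.take j) (s.take i)
      · linarith [hlarge _ _ hb]
      · linarith [(abs_lt.1 (hsmall _ _ hb)).1]
  have hT : ∀ i ∈ Finset.Ico (u.length + 1) (t.length + 1),
      φ (s.take j) (x (t.take i)) ≤ 1 / 320 := by
    intro i _
    -- As `j > |u|`, the segment `s.take j` is not an initial segment of `t`.
    refine (abs_lt.1 (hsmall _ _ fun hb => ?_)).2.le
    have := (hu _ (List.take_prefix j s) (hb.1.trans (List.take_prefix i t))).length_le
    rw [hlen j (hjk.trans hks)] at this
    omega
  have hS' := Finset.sum_le_sum hS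
  have hT' := Finset.sum_le_sum hT
  have hsub : Finset.Ico (u.length + 1) (s.length + 1) ∩ Finset.Icc j k = Finset.Icc j k :=
    Finset.inter_eq_right.2 fun i hi => by
      rw [Finset.mem_Icc] at hi
      rw [Finset.mem_Ico]
      omega
  rw [Finset.sum_sub_distrib, Finset.sum_ite_mem, hsub, Finset.sum_const, Finset.sum_const,
    Nat.card_Ico, Nat.card_Icc, nsmul_eq_mul, nsmul_eq_mul, Nat.add_sub_add_right,
    Nat.cast_sub hus] at hS'
  rw [Finset.sum_const, Nat.card_Ico, nsmul_eq_mul, Nat.add_sub_add_right,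
    Nat.cast_sub hut] at hT'
  have hval : φ (s.take j) (branchSum x s - branchSum x t) ≤ ‖branchSum x s - branchSum x t‖ :=
    (le_abs_self _).trans (((φ (s.take j)).le_opNorm _).trans
      (mul_le_of_le_one_left (norm_nonneg _) (hφ _)))
  have heq : φ (s.take j) (branchSum x s - branchSum x t) =
      ∑ i ∈ Finset.Ico (u.length + 1) (s.length + 1), φ (s.take j) (x (s.take i)) -
        ∑ i ∈ Finset.Ico (u.length + 1) (t.length + 1), φ (s.take j) (x (t.take i)) := by
    rw [branchSum_sub_branchSum x hs ht, map_sub, map_sum, map_sum]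
  have hcard' : (s.length : ℝ) - u.length ≤ 4 * ((k + 1 - j : ℕ) : ℝ) := by
    rw [← Nat.cast_sub hus]
    exact_mod_cast hcard
  have h1 : (t.length : ℝ) ≤ s.length := by exact_mod_cast hts
  have h2 : (u.length : ℝ) ≤ t.length := by exact_mod_cast hut
  linarith

end BranchSum

theorem embedsWithDistortion_of_dist_le {M N : Type*} [MetricSpace M] [MetricSpace N] {C : ℝ}
    (hC : 0 ≤ C) {f : M → N} (hf : ∀ a b, dist (f a) (f b) ≤ dist a b)
    (hf' : ∀ a b, dist a b ≤ C * dist (f a) (f b)) : EmbedsWithDistortion C M N := by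
  refine ⟨f, fun a b hab => ?_, ?_⟩
  · have h := hf' a b
    rw [hab, dist_self, mul_zero] at h
    exact dist_le_zero.1 h
  · rw [← one_mul (ENNReal.ofReal C)]
    refine mul_le_mul' (iSup_le fun a => iSup_le fun b => iSup_le fun _ => ?_)
      (iSup_le fun a => iSup_le fun b => iSup_le fun _ => ?_)
    · refine ENNReal.div_le_of_le_mul ?_
      rw [one_mul, edist_dist, edist_dist]
      exact ENNReal.ofReal_le_ofReal (hf a b)
    · refine ENNReal.div_le_of_le_mul ?_
      rw [edist_dist, edist_dist, ← ENNReal.ofReal_mul hC]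
      exact ENNReal.ofReal_le_ofReal (hf' a b)

theorem mainTheorem5 :
    ∃ C : ℝ, 1 ≤ C ∧
      ∀ (X : Type*) [NormedAddCommGroup X] [NormedSpace ℝ X] [CompleteSpace X]
        [TopologicalSpace.SeparableSpace X],
        ((Ordinal.omega0 : Ordinal) : WithTop Ordinal) < szlenkIndex (StrongDual ℝ X) →
          EmbedsWithDistortion C TInfty X := by
  refine ⟨300, by norm_num, fun X _ _ _ _ hsz => ?_⟩
  obtain ⟨x, φ, hx, hφ, hlarge, hsmall⟩ := exists_tree hsz
  have hlower : ∀ s t : TInfty, t.length ≤ s.length →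
      dist s t ≤ 300 * dist (branchSum x s) (branchSum x t) := fun s t hts => by
    rw [dist_eq_norm]
    exact le_norm_branchSum_sub hφ hlarge hsmall (TInfty.gca_left s t) (TInfty.gca_right s t)
      (fun v h h' => (TInfty.isAncestor_gca_iff v s t).2 ⟨h, h'⟩) hts
  refine embedsWithDistortion_of_dist_le (f := branchSum x) (by norm_num) (fun s t => ?_)
    fun s t => ?_
  · rw [dist_eq_norm]
    exact norm_branchSum_sub_le hx (TInfty.gca_left s t) (TInfty.gca_right s t)
  -- The lower estimate tests along the longer branch, so the two cases are exchanged by symmetry.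
  · rcases le_total t.length s.length with h | h
    · exact hlower s t h
    · rw [dist_comm s t, dist_comm (branchSum x s)]
      exact hlower t s h
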